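/- Let $q\ge 5$ be an odd prime power, let $m=2t+1\ge 5$ and $n=\frac{q^m+1}{q+1}$, and let $\beta$ be a primitive $n$-th root of unity in an extension field of $\mathbb F_q$. For integers $\delta\ge 2$ and $b\ge 0$ let $\mathcal C_{(n,q,\delta,b)}$ denote the BCH code, that is, the cyclic code of length $n$ over $\mathbb F_q$ whose generator polynomial is the least common multiple of the minimal polynomials over $\mathbb F_q$ of $\beta^{b},\beta^{b+1},\dots,\beta^{b+\delta-2}$. A linear code $\mathcal C$ is called LCD if $\mathcal C\cap\mathcal C^{\perp}=\{0\}$, where $\mathcal C^\perp$ is the Euclidean dual. Put $\epsilon=\lceil(\delta-1)(1-q^{-1})\rceil$ and $$A=\frac{q^{t+1}+2q^t+1}{q+1},\quad B=2\,\frac{q^{t+1}-1}{q+1}-1\qquad\text{if } t \text{ is odd},$$ $$A=\frac{q^{t+1}+2q^t-1}{q+1},\quad B=2\,\frac{q^{t+1}+1}{q+1}-1\qquad\text{if } t \text{ is even}.$$ For an integer $\delta$ with $q^t+2\le\delta\le B$ set $$k=\begin{cases} n-2m(\epsilon-1), & \text{if } q^t+2\le\delta\le A,\\ n-2m(\epsilon-2),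 & \text{if } A+1\le\delta\le B.\end{cases}$$ Then $\mathcal C_{(n,q,\delta,1)}$ is an LCD code of length $n$, dimension $k$ and minimum Hamming distance at least $\delta$, and $\mathcal C_{(n,q,\delta+1,0)}$ is an LCD code of length $n$, dimension $k-1$ and minimum Hamming distance at least $2\delta$. -/

import Mathlib

open Polynomial

noncomputable section

/-- The (Euclidean) dual of a linear code `C ⊆ F ^ n`. -/
def dualCode {F : Type*} [Field F] {n : ℕ} (C : Submodule F (Fin n → F)) :
    Submodule F (Fin n → F) where
  carrier := {b | ∀ c ∈ C, b ⬝ᵥ c = 0}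
  zero_mem' := fun c _ => zero_dotProduct c
  add_mem' := fun ha hb c hc => by rw [add_dotProduct, ha c hc, hb c hc, add_zero]
  smul_mem' := fun r b hb c hc => by rw [smul_dotProduct, hb c hc, smul_zero]

/-- `C` is an LCD code: it meets its dual trivially. -/
def IsLCD {F : Type*} [Field F] {n : ℕ} (C : Submodule F (Fin n → F)) : Prop :=
  C ⊓ dualCode C = ⊥

/-- The minimum Hamming distance between two distinct codewords of `C`. (It is `0` if there are
no two distinct codewords, so that a positive lower bound also says that `C` is nonzero.) -/
def minDistance {F : Type*} [DecidableEq F] {n : ℕ} (C : Set (Fin n → F)) : ℕ :=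
  sInf {d : ℕ | ∃ x ∈ C, ∃ y ∈ C, x ≠ y ∧ hammingDist x y = d}

/-- The identification of a word `(c₀, …, c_{n-1})` with the class of
`c₀ + c₁ x + ⋯ + c_{n-1} x ^ (n-1)` in `F[x] / ⟨x ^ n - 1⟩`. -/
def wordClass (F : Type*) [Field F] (n : ℕ) :
    (Fin n → F) →ₗ[F] F[X] ⧸ Ideal.span {(X ^ n - 1 : F[X])} :=
  (Ideal.Quotient.mkₐ F (Ideal.span {(X ^ n - 1 : F[X])})).toLinearMap ∘ₗ
    (∑ i : Fin n, (monomial (i : ℕ) : F →ₗ[F] F[X]) ∘ₗ LinearMap.proj i)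

/-- The cyclic code of length `n` that corresponds to the ideal `⟨g⟩` of
`F[x] / ⟨x ^ n - 1⟩`. -/
def cyclicCode {F : Type*} [Field F] (n : ℕ) (g : F[X]) : Submodule F (Fin n → F) :=
  ((Ideal.span {Ideal.Quotient.mk (Ideal.span {(X ^ n - 1 : F[X])}) g}).restrictScalars F).comap
    (wordClass F n)

open Classical in
/-- The monic least common multiple of the minimal polynomials over `F` of
`β ^ b, β ^ (b + 1), …, β ^ (b + δ - 2)` (used for `2 ≤ δ`). -/
def bchGenerator (F : Type*) [Field F] {K : Type*} [Field K] [Algebra F K]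
    (β : K) (δ b : ℕ) : F[X] :=
  letI : NormalizedGCDMonoid F[X] := UniqueFactorizationMonoid.toNormalizedGCDMonoid F[X]
  (Finset.Icc b (b + δ - 2)).lcm fun i => minpoly F (β ^ i)

/-- The BCH code of length `n` over `F` with designed distance `δ` and offset `b`, with respect
to the primitive `n`-th root of unity `β` in an extension of `F`. -/
def bchCode (F : Type*) [Field F] {K : Type*} [Field K] [Algebra F K]
    (β : K) (n δ b : ℕ) : Submodule F (Fin n → F) :=
  cyclicCode n (bchGenerator F β δ b)

end

/-! Everything rests on `q ^ m ≡ -1` modulo `n`. Since evaluation of a polynomial over `F` commutes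
with `x ↦ x ^ q`, the set of zeros of any cyclic code of length `n` is closed under inversion. This
makes the code LCD (`isLCD_of_shift`). It also makes the zeros `1, β, …, β ^ (δ - 1)` of the second
code part of a run of `2δ - 1` consecutive ones, so the BCH bound yields `2δ`.

The dimension is `n` minus the degree of the generator, so the `q`-cyclotomic cosets meeting `[1, δ
- 1]` must be counted. Each coset met has a member there that is prime to the shift, in the sense of
not being divisible by `q`; there are `ε` such integers. Write `Q = q ^ t`, `s = (-1) ^ t` and `(q +
1) d = Q - s`. For such integers up to `2Q - 2d - 2`, every coset has the full size `2m`, and the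
only coincidences are `Q - d ~ d` and `Q + d ~ Q - d + s` (`CosetData.cases_of_dvd`). As `A = Q + d`
and `B = 2Q - 2d - 1`, one coset is lost when `δ ≤ A` and two beyond, which are the two cases for
`k`. -/

/-! ### Cyclic codes as multiples of a generator; the BCH bound. -/

section WordPolynomials

variable {F K : Type*} [Field F] [Field K] [Algebra F K] {n : ℕ}

/-- The polynomial `c₀ + c₁ x + ⋯ + c_{n-1} x ^ (n-1)` of a word. -/
noncomputable def wordPoly (F : Type*) [Field F] (n : ℕ) : (Fin n → F) →ₗ[F] F[X] :=
  ∑ i : Fin n, (monomial (i : ℕ) : F →ₗ[F] F[X]) ∘ₗ LinearMap.proj i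

theorem wordPoly_apply (c : Fin n → F) : wordPoly F n c = ∑ i : Fin n, monomial (i : ℕ) (c i) := by
  simp [wordPoly]

theorem aeval_wordPoly (c : Fin n → F) (x : K) :
    aeval x (wordPoly F n c) = ∑ k, algebraMap F K (c k) * x ^ (k : ℕ) := by
  simp [wordPoly_apply, aeval_monomial]

theorem wordPoly_coeff_fin (p : F[X]) (hp : p.degree < n) :
    wordPoly F n (fun i => p.coeff i) = p := by
  rw [wordPoly_apply, Fin.sum_univ_eq_sum_range (fun i => monomial i (p.coeff i)) n]
  by_cases h0 : p = 0
  · simp [h0]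
  · exact (p.as_sum_range' n ((natDegree_lt_iff_degree_lt h0).2 hp)).symm

theorem mem_cyclicCode_iff {g : F[X]} (hg : g ∣ X ^ n - 1) (c : Fin n → F) :
    c ∈ cyclicCode n g ↔ g ∣ wordPoly F n c := by
  have h : c ∈ cyclicCode n g ↔ Ideal.Quotient.mk (Ideal.span {(X ^ n - 1 : F[X])})
      (wordPoly F n c) ∈ Ideal.span {Ideal.Quotient.mk (Ideal.span {(X ^ n - 1 : F[X])}) g} :=
    Iff.rfl
  rw [h, Ideal.mem_span_singleton]
  constructor
  · rintro ⟨a, ha⟩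
    obtain ⟨a, rfl⟩ := Ideal.Quotient.mk_surjective a
    rw [← map_mul, Ideal.Quotient.eq, Ideal.mem_span_singleton] at ha
    exact (dvd_iff_dvd_of_dvd_sub (hg.trans ha)).2 (dvd_mul_right g a)
  · rintro ⟨a, ha⟩
    exact ⟨Ideal.Quotient.mk _ a, by rw [ha, map_mul]⟩

/-- The code is the kernel of `F ^ n → F[X] / ⟨g⟩`, which is onto because remainders modulo `g` have
degree less than `n`. -/
theorem finrank_cyclicCode (hn : 0 < n) {g : F[X]} (hg : g ∣ X ^ n - 1) :
    Module.finrank F (cyclicCode n g) + g.natDegree = n := by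
  have hg0 : g ≠ 0 := ne_zero_of_dvd_ne_zero (X_pow_sub_C_ne_zero hn 1) (by simpa using hg)
  have hdeg : g.natDegree ≤ n := by
    have := natDegree_le_of_dvd (p := g) (by simpa using hg) (X_pow_sub_C_ne_zero hn (1 : F))
    rwa [natDegree_X_pow_sub_C] at this
  let φ : (Fin n → F) →ₗ[F] F[X] ⧸ Ideal.span {g} :=
    (Ideal.Quotient.mkₐ F (Ideal.span {g})).toLinearMap ∘ₗ wordPoly F n
  have hker : LinearMap.ker φ = cyclicCode n g := by
    ext c
    rw [mem_cyclicCode_iff hg, LinearMap.mem_ker]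
    change Ideal.Quotient.mk _ (wordPoly F n c) = 0 ↔ _
    rw [Ideal.Quotient.eq_zero_iff_mem, Ideal.mem_span_singleton]
  have hsurj : LinearMap.range φ = ⊤ := by
    rw [LinearMap.range_eq_top]
    intro y
    obtain ⟨p, rfl⟩ := Ideal.Quotient.mk_surjective y
    refine ⟨fun i => (p % g).coeff i, ?_⟩
    change Ideal.Quotient.mk _ (wordPoly F n _) = _
    rw [wordPoly_coeff_fin, Ideal.Quotient.eq, Ideal.mem_span_singleton]
    · exact ⟨-(p / g), by linear_combination EuclideanDomain.mod_add_div p g⟩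
    · refine (EuclideanDomain.mod_lt p hg0).trans_le ?_
      exact degree_le_of_natDegree_le hdeg
  have := φ.finrank_range_add_finrank_ker
  rw [hker, hsurj, finrank_top, finrank_quotient_span_eq_natDegree, Module.finrank_fin_fun] at this
  omega

/-- The BCH bound. -/
theorem eq_zero_of_hammingNorm_le [DecidableEq F] {β : K} (hβ : IsPrimitiveRoot β n)
    (c : Fin n → F) (a D : ℕ) (h : ∀ i < D, aeval (β ^ (a + i)) (wordPoly F n c) = 0)
    (hc : hammingNorm c ≤ D) : c = 0 := by
  classical
  by_contra hne
  obtain ⟨k, hk⟩ := Function.ne_iff.1 hne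
  -- Linear combinations of the `D` vanishing conditions pair the word with any polynomial of degree
  -- below `D`. The choice of `p` below kills every support position except `k`, which replaces a
  -- Vandermonde determinant.
  have hlin : ∀ p : K[X], p.natDegree < D →
      ∑ j, algebraMap F K (c j) * (β ^ (j : ℕ)) ^ a * p.eval (β ^ (j : ℕ)) = 0 := by
    intro p hp
    simp_rw [eval_eq_sum_range' hp, Finset.mul_sum]
    rw [Finset.sum_comm]
    refine Finset.sum_eq_zero fun i hi => ?_
    have := h i (Finset.mem_range.1 hi)
    rw [aeval_wordPoly] at this
    rw [← mul_zero (p.coeff i), ← this, Finset.mul_sum]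
    refine Finset.sum_congr rfl fun j _ => ?_
    rw [← pow_mul, ← pow_mul, ← pow_mul]
    ring
  let S : Finset (Fin n) := {j | c j ≠ 0}
  have hS : S.card ≤ D := hc
  have hkS : k ∈ S := by simpa [S] using hk
  let p : K[X] := ∏ j ∈ S.erase k, (X - C (β ^ (j : ℕ)))
  have hp : p.natDegree < D := by
    rw [natDegree_prod_of_monic _ _ fun j _ => monic_X_sub_C _]
    have := Finset.card_erase_lt_of_mem hkS
    simp only [natDegree_X_sub_C, Finset.sum_const, smul_eq_mul, mul_one]
    omega
  have hsum := hlin p hp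
  rw [Finset.sum_eq_single k] at hsum
  · have h0 : β ≠ 0 := hβ.ne_zero (by have := k.2; omega)
    have h1 : p.eval (β ^ (k : ℕ)) ≠ 0 := by
      rw [eval_prod, Finset.prod_ne_zero_iff]
      intro j hj
      rw [eval_sub, eval_X, eval_C, sub_ne_zero]
      intro he
      exact (Finset.ne_of_mem_erase hj) (Fin.ext (hβ.pow_inj k.2 j.2 he)).symm
    have h2 : algebraMap F K (c k) ≠ 0 := by simpa using hk
    exact mul_ne_zero (mul_ne_zero h2 (pow_ne_zero _ (pow_ne_zero _ h0))) h1 hsum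
  · intro j _ hj
    by_cases hcj : c j = 0
    · simp [hcj]
    · have : p.eval (β ^ (j : ℕ)) = 0 := by
        rw [eval_prod]
        exact Finset.prod_eq_zero (Finset.mem_erase.2 ⟨hj, by simpa [S] using hcj⟩) (by simp)
      rw [this, mul_zero]
  · simp

/-- A word whose polynomial vanishes at all `n`-th roots of unity is zero. -/
theorem eq_zero_of_forall_aeval_eq_zero {β : K} (hβ : IsPrimitiveRoot β n) (c : Fin n → F)
    (h : ∀ i, aeval (β ^ i) (wordPoly F n c) = 0) : c = 0 := by
  classical
  refine eq_zero_of_hammingNorm_le hβ c 0 n (fun i _ => h _) ?_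
  simpa using hammingNorm_le_card_fintype (x := c)

/-- Nonzeroness of `C` is needed because the infimum of the empty set is `0`. -/
theorem le_minDistance [DecidableEq F] {C : Submodule F (Fin n → F)} (hC : C ≠ ⊥) {d : ℕ}
    (h : ∀ c ∈ C, hammingNorm c < d → c = 0) : d ≤ minDistance (C : Set (Fin n → F)) := by
  obtain ⟨c, hc, hc0⟩ := C.ne_bot_iff.1 hC
  have hne : {d : ℕ | ∃ x ∈ (C : Set (Fin n → F)), ∃ y ∈ (C : Set (Fin n → F)),
      x ≠ y ∧ hammingDist x y = d}.Nonempty := ⟨_, c, hc, 0, C.zero_mem, hc0, rfl⟩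
  obtain ⟨x, hx, y, hy, hxy, hd⟩ := Nat.sInf_mem hne
  rw [minDistance, ← hd, hammingDist_eq_hammingNorm]
  by_contra! hlt
  exact hxy (neg_add_eq_zero.1 (h _ (C.add_mem (C.neg_mem hx) hy) hlt))

end WordPolynomials

/-! ### Zeros and degree of the BCH generator. -/

section Generator

variable {F K : Type*} [Field F] [Field K] [Algebra F K] {n : ℕ}

theorem bchGenerator_dvd_iff (β : K) (δ b : ℕ) (p : F[X]) :
    bchGenerator F β δ b ∣ p ↔ ∀ i ∈ Finset.Icc b (b + δ - 2), minpoly F (β ^ i) ∣ p := by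
  classical
  let := UniqueFactorizationMonoid.toNormalizedGCDMonoid F[X]
  exact Finset.lcm_dvd_iff

theorem bchGenerator_dvd_iff_aeval (β : K) (δ b : ℕ) (p : F[X]) :
    bchGenerator F β δ b ∣ p ↔ ∀ i ∈ Finset.Icc b (b + δ - 2), aeval (β ^ i) p = 0 := by
  simp_rw [bchGenerator_dvd_iff, minpoly.dvd_iff]

theorem bchGenerator_dvd_X_pow_sub_one {β : K} (hβ : β ^ n = 1) (δ b : ℕ) :
    bchGenerator F β δ b ∣ X ^ n - 1 := by
  rw [bchGenerator_dvd_iff_aeval]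
  intro i _
  simp [← pow_mul, mul_comm i, pow_mul β n, hβ]

theorem mem_bchCode_iff {β : K} (hβ : β ^ n = 1) (δ b : ℕ) (c : Fin n → F) :
    c ∈ bchCode F β n δ b ↔
      ∀ i ∈ Finset.Icc b (b + δ - 2), aeval (β ^ i) (wordPoly F n c) = 0 := by
  rw [bchCode, mem_cyclicCode_iff (bchGenerator_dvd_X_pow_sub_one hβ δ b),
    bchGenerator_dvd_iff_aeval]

/-- The BCH code depends only on the minimal polynomials of the powers of `β`. -/
theorem bchCode_congr {L : Type*} [Field L] [Algebra F L] {β : K} {γ : L}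
    (h : ∀ i : ℕ, minpoly F (β ^ i) = minpoly F (γ ^ i)) (n δ b : ℕ) :
    bchCode F β n δ b = bchCode F γ n δ b := by
  unfold bchCode bchGenerator
  simp_rw [h]

/-- If `R` represents each minimal polynomial occurring in the generator exactly once, the degree
of the generator is the sum of the degrees over `R`. -/
theorem natDegree_bchGenerator {β : K} (hβ : IsIntegral F β) (δ b : ℕ) (R : Finset ℕ)
    (hR : R ⊆ Finset.Icc b (b + δ - 2))
    (hinj : ∀ i ∈ R, ∀ j ∈ R, minpoly F (β ^ i) = minpoly F (β ^ j) → i = j)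
    (hrep : ∀ i ∈ Finset.Icc b (b + δ - 2), ∃ j ∈ R, minpoly F (β ^ i) = minpoly F (β ^ j)) :
    (bchGenerator F β δ b).natDegree = ∑ i ∈ R, (minpoly F (β ^ i)).natDegree := by
  have hmonic : ∀ i ∈ R, (minpoly F (β ^ i)).Monic := fun i _ => minpoly.monic (hβ.pow i)
  rw [← natDegree_prod_of_monic _ _ hmonic]
  have h1 : bchGenerator F β δ b ∣ ∏ i ∈ R, minpoly F (β ^ i) := by
    rw [bchGenerator_dvd_iff]
    intro i hi
    obtain ⟨j, hj, hij⟩ := hrep i hi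
    rw [hij]
    exact Finset.dvd_prod_of_mem _ hj
  -- Distinct monic irreducibles are coprime, so their product divides any common multiple.
  have h2 : ∏ i ∈ R, minpoly F (β ^ i) ∣ bchGenerator F β δ b := by
    refine Finset.prod_dvd_of_coprime (fun i hi j hj hij => ?_) fun i hi =>
      (bchGenerator_dvd_iff β δ b _).1 dvd_rfl i (hR hi)
    have hirr := minpoly.irreducible (hβ.pow i)
    refine (hirr.coprime_iff_not_dvd).2 fun hd => hij (hinj i hi j hj ?_)
    exact eq_of_monic_of_associated (hmonic i hi) (hmonic j hj)
      (hirr.associated_of_dvd (minpoly.irreducible (hβ.pow j)) hd)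
  have h3 := (monic_prod_of_monic _ _ hmonic).ne_zero
  exact le_antisymm (natDegree_le_of_dvd h1 h3)
    (natDegree_le_of_dvd h2 (ne_zero_of_dvd_ne_zero h3 h1))

end Generator

/-! ### Evaluation under cyclic shifts. -/

section CyclicShift

variable {F K : Type*} [Field F] [Field K] [Algebra F K] {n : ℕ}

theorem pow_fin_add {M : Type*} [Monoid M] [NeZero n] {x : M} (hx : x ^ n = 1) (k s : Fin n) :
    x ^ ((k + s : Fin n) : ℕ) = x ^ (k : ℕ) * x ^ (s : ℕ) := by
  rw [← pow_add, Fin.val_add, ← pow_mod_orderOf, Nat.mod_mod_of_dvd _ (orderOf_dvd_of_pow_eq_one hx),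
    pow_mod_orderOf]

theorem aeval_wordPoly_shift [NeZero n] {x : K} (hx : x ^ n = 1) (c : Fin n → F) (s : Fin n) :
    aeval x (wordPoly F n fun k => c (k + s)) * x ^ (s : ℕ) = aeval x (wordPoly F n c) := by
  rw [aeval_wordPoly, aeval_wordPoly, Finset.sum_mul,
    ← Equiv.sum_comp (Equiv.addRight s) fun k => algebraMap F K (c k) * x ^ (k : ℕ)]
  refine Finset.sum_congr rfl fun k _ => ?_
  rw [mul_assoc, Equiv.coe_addRight, pow_fin_add hx]

end CyclicShift

theorem pow_pow_eq_pow_sub {K : Type*} [Field K] {n : ℕ} {β : K} {Q : ℕ} (hβ : β ^ n = 1)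
    (hn : n ∣ Q + 1) {i : ℕ} (hi : i ≤ n) : (β ^ i) ^ Q = β ^ (n - i) := by
  obtain ⟨r, hr⟩ := hn
  have h1 : (β ^ i) ^ Q * β ^ i = 1 := by
    rw [← pow_succ, hr, ← pow_mul, mul_left_comm, pow_mul, hβ, one_pow]
  have h2 : β ^ (n - i) * β ^ i = 1 := by rw [← pow_add, Nat.sub_add_cancel hi, hβ]
  exact mul_right_cancel₀ (right_ne_zero_of_mul_eq_one h1) (h1.trans h2.symm)

/-! ### Frobenius conjugates and minimal polynomials. -/

section FiniteField

variable {F K : Type*} [Field F] [Fintype F] [Field K] [Algebra F K]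

theorem aeval_pow_card_pow (x : K) (p : F[X]) (l : ℕ) :
    aeval (x ^ Fintype.card F ^ l) p = (aeval x p) ^ Fintype.card F ^ l := by
  induction l with
  | zero => simp
  | succ l ih =>
    have : ∀ y : K, y ^ Fintype.card F = FiniteField.frobeniusAlgHom F K y := fun y => rfl
    rw [pow_succ, pow_mul, pow_mul, ← ih, this, this, aeval_algHom_apply]

theorem minpoly_pow_card_pow {x : K} (hx : IsIntegral F x) (l : ℕ) :
    minpoly F (x ^ Fintype.card F ^ l) = minpoly F x := by
  refine (minpoly.eq_of_irreducible_of_monic (minpoly.irreducible hx) ?_ (minpoly.monic hx)).symm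
  rw [aeval_pow_card_pow, minpoly.aeval, zero_pow]
  exact pow_ne_zero _ Fintype.card_ne_zero

/-- Roots of one irreducible polynomial are conjugate, and the automorphisms of the finite field `K`
over `F` are powers of Frobenius. -/
theorem exists_eq_pow_card_pow_of_minpoly_eq [Finite K] {x y : K}
    (h : minpoly F x = minpoly F y) : ∃ l : ℕ, y = x ^ Fintype.card F ^ l := by
  obtain ⟨p, hp⟩ := CharP.exists F
  have : Fact p.Prime := ⟨CharP.char_is_prime F p⟩
  obtain ⟨σ, hσ⟩ := minpoly.exists_algEquiv_of_root' (K := F) (L := K) (x := y) (y := x)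
    (Algebra.IsAlgebraic.isAlgebraic x) (by rw [h, minpoly.aeval])
  obtain ⟨l, hl⟩ := FiniteField.exists_forall_apply_eq_pow F p K σ
  exact ⟨l, by rw [← hσ, hl, Nat.card_eq_fintype_card]⟩

theorem natDegree_minpoly_eq_of_pow_card_pow {x : K} (hx : IsIntegral F x) {r : ℕ} (hr : 0 < r)
    (h : x ^ Fintype.card F ^ r = x) (hmin : ∀ l, 0 < l → l < r → x ^ Fintype.card F ^ l ≠ x) :
    (minpoly F x).natDegree = r := by
  have hiff : ∀ l, (minpoly F x).natDegree ∣ l ↔ x ^ Fintype.card F ^ l = x := by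
    intro l
    rw [(minpoly.irreducible hx).natDegree_dvd_iff_dvd_X_pow_card_pow_sub_X, minpoly.dvd_iff]
    simp [sub_eq_zero]
  refine le_antisymm (Nat.le_of_dvd hr ((hiff r).2 h)) ?_
  by_contra! hlt
  exact hmin _ (minpoly.natDegree_pos hx) hlt ((hiff _).1 dvd_rfl)

end FiniteField

/-! ### The LCD property. -/

section LCD

variable {F K : Type*} [Field F] [Fintype F] [Field K] [Algebra F K] {n m : ℕ}

/-- A code which is closed under cyclic shifts is LCD if `-1` is a power of the cardinality of the
base field modulo its length. -/
theorem isLCD_of_shift [NeZero n] {β : K} (hβ : IsPrimitiveRoot β n)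
    (hn : n ∣ Fintype.card F ^ m + 1) {C : Submodule F (Fin n → F)}
    (hC : ∀ c ∈ C, ∀ s, (fun k => c (k + s)) ∈ C) : IsLCD C := by
  rw [IsLCD, eq_bot_iff]
  rintro c ⟨hc, hcd⟩
  refine eq_zero_of_forall_aeval_eq_zero hβ c fun i => ?_
  set x := β ^ i with hx
  have hxn : x ^ n = 1 := by rw [hx, ← pow_mul, mul_comm, pow_mul, hβ.pow_eq_one, one_pow]
  set y := x ^ Fintype.card F ^ m with hy
  have hxy : x * y = 1 := by
    obtain ⟨r, hr⟩ := hn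
    rw [hy, ← pow_succ', hr, pow_mul, hxn, one_pow]
  have hdot : ∀ s : Fin n, ∑ k, c k * c (k + s) = 0 := fun s => hcd _ (hC c hc s)
  -- With `y = x⁻¹`, the coefficients of `c(y) c(x)` are the inner products of `c` with its cyclic
  -- shifts, all zero.
  have hprod : aeval y (wordPoly F n c) * aeval x (wordPoly F n c) = 0 := by
    calc aeval y (wordPoly F n c) * aeval x (wordPoly F n c)
        = ∑ k, algebraMap F K (c k) * y ^ (k : ℕ) * aeval x (wordPoly F n c) := by
          rw [aeval_wordPoly c y, Finset.sum_mul]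
      _ = ∑ k, ∑ s : Fin n, algebraMap F K (c k * c (k + s)) * x ^ (s : ℕ) := by
          refine Finset.sum_congr rfl fun k _ => ?_
          rw [← aeval_wordPoly_shift hxn c k, aeval_wordPoly, Finset.sum_mul, Finset.mul_sum]
          refine Finset.sum_congr rfl fun s _ => ?_
          have : x ^ (k : ℕ) * y ^ (k : ℕ) = 1 := by rw [← mul_pow, hxy, one_pow]
          rw [map_mul, add_comm k s]
          linear_combination (algebraMap F K (c k) * algebraMap F K (c (s + k)) * x ^ (s : ℕ)) * this
      _ = ∑ s : Fin n, algebraMap F K (∑ k, c k * c (k + s)) * x ^ (s : ℕ) := by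
          rw [Finset.sum_comm]
          simp_rw [map_sum, Finset.sum_mul]
      _ = 0 := by simp [hdot]
  -- Since `y` is a Frobenius power of `x`, the product is a power of `c(x)`.
  rw [hy, aeval_pow_card_pow, ← pow_succ] at hprod
  exact eq_zero_of_pow_eq_zero hprod

theorem isLCD_bchCode [NeZero n] {β : K} (hβ : IsPrimitiveRoot β n)
    (hn : n ∣ Fintype.card F ^ m + 1) (δ b : ℕ) : IsLCD (bchCode F β n δ b) := by
  refine isLCD_of_shift hβ hn fun c hc s => ?_
  rw [mem_bchCode_iff hβ.pow_eq_one] at hc ⊢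
  intro i hi
  have hxn : (β ^ i) ^ n = 1 := by rw [← pow_mul, mul_comm, pow_mul, hβ.pow_eq_one, one_pow]
  have h := aeval_wordPoly_shift hxn c s
  rw [hc i hi] at h
  exact (mul_eq_zero.1 h).resolve_right
    (pow_ne_zero _ (pow_ne_zero _ (hβ.ne_zero (NeZero.ne n))))

end LCD

/-! ### Lower bounds for the minimum distance. -/

section MinimumDistance

theorem le_minDistance_bchCode_one {F K : Type*} [Field F] [DecidableEq F] [Field K] [Algebra F K] {n : ℕ}
    {β : K} (hβ : IsPrimitiveRoot β n) {δ : ℕ} (hδ : 2 ≤ δ)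
    (hC : bchCode F β n δ 1 ≠ ⊥) : δ ≤ minDistance (bchCode F β n δ 1 : Set (Fin n → F)) := by
  refine le_minDistance hC fun c hc hw =>
    eq_zero_of_hammingNorm_le hβ c 1 (δ - 1) (fun i hi => ?_) (by omega)
  exact (mem_bchCode_iff hβ.pow_eq_one δ 1 c).1 hc _ (Finset.mem_Icc.2 (by omega))

variable {F K : Type*} [Field F] [Fintype F] [DecidableEq F] [Field K] [Algebra F K] {n m : ℕ}

/-- Zeros come in inverse pairs, so the exponents from `-(δ - 1)` to `δ - 1` are all zeros. The run
is started at `n - (δ - 1)` to keep exponents natural. -/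
theorem two_mul_le_minDistance_bchCode_zero {β : K} (hβ : IsPrimitiveRoot β n)
    (hn : n ∣ Fintype.card F ^ m + 1) {δ : ℕ} (hδ : 1 ≤ δ) (hδn : δ ≤ n)
    (hC : bchCode F β n (δ + 1) 0 ≠ ⊥) :
    2 * δ ≤ minDistance (bchCode F β n (δ + 1) 0 : Set (Fin n → F)) := by
  refine le_minDistance hC fun c hc hw =>
    eq_zero_of_hammingNorm_le hβ c (n - (δ - 1)) (2 * δ - 1) (fun i hi => ?_) (by omega)
  have hz : ∀ j < δ, aeval (β ^ j) (wordPoly F n c) = 0 := fun j hj =>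
    (mem_bchCode_iff hβ.pow_eq_one _ _ c).1 hc _ (Finset.mem_Icc.2 (by omega))
  rcases le_or_gt (δ - 1) i with h | h
  · have : n - (δ - 1) + i = n + (i - (δ - 1)) := by omega
    rw [this, pow_add, hβ.pow_eq_one, one_mul]
    exact hz _ (by omega)
  · have : n - (δ - 1) + i = n - (δ - 1 - i) := by omega
    rw [this, ← pow_pow_eq_pow_sub hβ.pow_eq_one hn (by omega), aeval_pow_card_pow,
      hz _ (by omega), zero_pow (pow_ne_zero _ Fintype.card_ne_zero)]

end MinimumDistance

/-! ### Coincidences between cyclotomic cosets. -/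

section CyclotomicCosets

/-- Numerical data of the length `n = (q ^ (2 * t + 1) + 1) / (q + 1)`: `s` is the sign for which
`q + 1` divides `q ^ t - s`, and `d` is the quotient. -/
structure CosetData (q t n : ℕ) (d s : ℤ) : Prop where
  five_le : 5 ≤ q
  odd : Odd q
  two_le : 2 ≤ t
  length : n * (q + 1) = q ^ (2 * t + 1) + 1
  sign : s = 1 ∨ s = -1
  quot : ((q : ℤ) + 1) * d = (q : ℤ) ^ t - s

/-- The pairs of distinct positive integers `i, j` below the bound, not divisible by `q`, with
`i * q ^ t ≡ ± j` modulo `n`. -/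
def ExceptionalPair (q t : ℕ) (d s i j : ℤ) : Prop :=
  (i = (q : ℤ) ^ t - d ∧ j = d) ∨ (i = (q : ℤ) ^ t - d + s ∧ j = (q : ℤ) ^ t + d)

namespace CosetData

variable {q t n : ℕ} {d s : ℤ} (h : CosetData q t n d s)
include h

theorem length_int : (n : ℤ) * (q + 1) = q * ((q : ℤ) ^ t) ^ 2 + 1 := by
  have := h.length
  zify at this
  rw [this]
  ring

theorem five_le_int : (5 : ℤ) ≤ q := by exact_mod_cast h.five_le

theorem sq_le_pow : (q : ℤ) ^ 2 ≤ (q : ℤ) ^ t :=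
  pow_le_pow_right₀ (by linarith [h.five_le_int]) h.two_le

theorem dvd_pow : (q : ℤ) ∣ (q : ℤ) ^ t := dvd_pow_self _ (by linarith [h.two_le])

theorem quot_pos : 4 ≤ d := by
  have h1 := h.sq_le_pow
  have h2 := h.five_le_int
  have h3 := h.quot
  have h4 : s ≤ 1 := by rcases h.sign with h | h <;> omega
  by_contra! hd
  nlinarith

theorem bound {i : ℤ} (hi : i ≤ 2 * (q : ℤ) ^ t - 2 * d - 2) :
    ((q : ℤ) + 1) * i ≤ 2 * q * (q : ℤ) ^ t - 2 * q := by
  have h2 := h.five_le_int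
  have h3 := h.quot
  have h4 : s ≤ 1 := by rcases h.sign with h | h <;> omega
  nlinarith

/-- Multiply `i Q - σ j = c n` by `q + 1`. Size gives `c = 0` or `c = 1`, and `c = 0` would make `q`
divide `j`. For `c = 1`, reduction modulo `Q` and modulo `q + 1` leaves three candidates for `i`,
one of them divisible by `q`. -/
theorem exceptionalPair_of_dvd {i j σ : ℤ} (hσ : σ = 1 ∨ σ = -1) (hi : 0 < i) (hj : 0 < j)
    (hi' : i ≤ 2 * (q : ℤ) ^ t - 2 * d - 2) (hj' : j ≤ 2 * (q : ℤ) ^ t - 2 * d - 2)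
    (hqi : ¬ (q : ℤ) ∣ i) (hqj : ¬ (q : ℤ) ∣ j) (hdvd : (n : ℤ) ∣ i * (q : ℤ) ^ t - σ * j) :
    ExceptionalPair q t d s i j := by
  have hq := h.five_le_int
  have hQ := h.sq_le_pow
  have hd := h.quot
  have hn := h.length_int
  have hqQ := h.dvd_pow
  have bi := h.bound hi'
  have bj := h.bound hj'
  unfold ExceptionalPair
  generalize (q : ℤ) ^ t = Q at *
  obtain ⟨c, hc⟩ := hdvd
  have hQpos : 0 < Q := by nlinarith
  have hqQ' : (q : ℤ) ≤ Q := by nlinarith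
  have hj1 : σ * j ≤ j ∧ -j ≤ σ * j := by rcases hσ with rfl | rfl <;> constructor <;> linarith
  have key : c * (q * Q ^ 2 + 1) = (q + 1) * i * Q - σ * ((q + 1) * j) := by
    rw [← hn]; linear_combination (-(q : ℤ) - 1) * hc
  have hkey1 : σ * ((q + 1) * j) ≤ 2 * q * Q - 2 * q := by nlinarith
  have hkey2 : -(2 * q * Q - 2 * q) ≤ σ * ((q + 1) * j) := by nlinarith
  have hiQ : 0 < (q + 1) * i * Q := by positivity
  have hiQ' : (q + 1) * i * Q ≤ (2 * q * Q - 2 * q) * Q := by gcongr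
  have hqQ2 : 0 ≤ q * Q := by positivity
  have hc0 : 0 ≤ c := by
    by_contra! hneg
    nlinarith
  have hc2 : c < 2 := by
    by_contra! hge
    nlinarith
  have hc1 : c = 1 := by
    have : c ≠ 0 := by
      rintro rfl
      apply hqj
      have h1 : i * Q = σ * j := by linarith
      have h2 : (q : ℤ) ∣ σ * j := h1 ▸ hqQ.mul_left i
      rcases hσ with rfl | rfl
      · simpa using h2
      · simpa using h2
    omega
  subst hc1
  obtain ⟨w, hw⟩ : Q ∣ 1 + σ * ((q + 1) * j) := ⟨(q + 1) * i - q * Q, by linear_combination key⟩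
  have hiw : (q + 1) * i = q * Q + w := by
    have : Q * ((q + 1) * i - q * Q - w) = 0 := by linear_combination hw - key
    rcases mul_eq_zero.1 this with h0 | h0
    · omega
    · linarith
  have hs := h.sign
  -- Modulo `q + 1` one has `q ≡ -1` and `Q ≡ s`, so `(q + 1) i = q Q + w` forces `w ≡ s`.
  have hdw : ((q : ℤ) + 1) ∣ w - s := by
    refine ⟨i - Q + d, ?_⟩
    linear_combination -hiw - hd
  obtain ⟨u, hu⟩ := hdw
  have hwlt : w < 2 * q := by
    by_contra! hge
    linarith [mul_le_mul_of_nonneg_left hge hQpos.le]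
  have hwgt : -(2 * q) < w := by
    by_contra! hge
    linarith [mul_le_mul_of_nonneg_left hge hQpos.le]
  have hu1 : u < 2 := by
    by_contra! hge
    have : -1 ≤ s := by rcases hs with h | h <;> omega
    nlinarith
  have hu2 : -2 < u := by
    by_contra! hge
    have : s ≤ 1 := by rcases hs with h | h <;> omega
    nlinarith
  have hq1 : ((q : ℤ) + 1) ≠ 0 := by positivity
  have hs2 : s * s = 1 := by rcases hs with rfl | rfl <;> norm_num
  have hσ2 : σ * σ = 1 := by rcases hσ with rfl | rfl <;> norm_num
  have hd4 := h.quot_pos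
  rcases (by rcases hs with rfl | rfl <;> omega : u = 0 ∨ u = s ∨ u = -s) with rfl | rfl | rfl
  · left
    have hws : w = s := by linarith
    subst hws
    have hi1 : i = Q - d := mul_left_cancel₀ hq1 (by linear_combination hiw + hd)
    have hj1 : j = σ * w * d :=
      mul_left_cancel₀ hq1 (by linear_combination σ * hw - (q + 1) * j * hσ2 - σ * w * hd + σ * hs2)
    refine ⟨hi1, ?_⟩
    rcases hσ with rfl | rfl <;> rcases hs with rfl | rfl <;> linarith
  · right
    have hws : w = u * (q + 2) := by linear_combination hu
    have hi1 : i = Q - d + u := mul_left_cancel₀ hq1 (by linear_combination hiw + hd + hws)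
    have hj1 : j = σ * u * (Q + d) :=
      mul_left_cancel₀ hq1 (by
        linear_combination σ * hw - (q + 1) * j * hσ2 - σ * u * hd + σ * hs2 + σ * Q * hws)
    refine ⟨hi1, ?_⟩
    rcases hσ with rfl | rfl <;> rcases hs with rfl | rfl <;> linarith
  · exfalso
    apply hqi
    have hws : w = -s * q := by linear_combination hu
    exact ⟨Q - s - i, by linear_combination hiw + hws⟩

/-- For `l < t` the number `i q ^ l - σ j` is smaller than `n` in absolute value, so it vanishes.
Positivity then fixes the sign, and `q ∤ j` forces `l = 0`. -/
theorem eq_of_dvd_of_lt {i j σ : ℤ} (hσ : σ = 1 ∨ σ = -1) (hi : 0 < i) (hj : 0 < j)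
    (hi' : i ≤ 2 * (q : ℤ) ^ t - 2 * d - 2) (hj' : j ≤ 2 * (q : ℤ) ^ t - 2 * d - 2)
    (hqj : ¬ (q : ℤ) ∣ j) {l : ℕ} (hl : l < t)
    (hdvd : (n : ℤ) ∣ i * (q : ℤ) ^ l - σ * j) : l = 0 ∧ i = j ∧ σ = 1 := by
  have hq := h.five_le_int
  have hQ := h.sq_le_pow
  have hn := h.length_int
  have bi := h.bound hi'
  have bj := h.bound hj'
  have hP : (q : ℤ) ^ l * q ≤ (q : ℤ) ^ t := by
    rw [← pow_succ]
    exact pow_le_pow_right₀ (by linarith) hl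
  have hP1 : (1 : ℤ) ≤ (q : ℤ) ^ l := one_le_pow₀ (by linarith)
  have hz : i * (q : ℤ) ^ l - σ * j = 0 := by
    generalize (q : ℤ) ^ t = Q at *
    generalize (q : ℤ) ^ l = P at *
    refine Int.eq_zero_of_abs_lt_dvd hdvd ?_
    have hjj : |σ * j| = j := by rcases hσ with rfl | rfl <;> simp [abs_of_pos hj]
    have hii : |i * P| = i * P := abs_of_pos (by positivity)
    have habs : |i * P - σ * j| ≤ i * P + j := by
      have := abs_sub (i * P) (σ * j)
      rwa [hii, hjj] at this
    refine habs.trans_lt ?_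
    have hqQ : (q : ℤ) ≤ Q := by nlinarith
    have h1 : (q + 1) * i * P ≤ (2 * Q - 2) * (P * q) := by nlinarith
    have h2 : (2 * Q - 2) * (P * q) ≤ (2 * Q - 2) * Q :=
      mul_le_mul_of_nonneg_left hP (by linarith)
    have h3 : (i * P + j) * (q + 1) < n * (q + 1) := by
      rw [hn]
      nlinarith
    exact lt_of_mul_lt_mul_right h3 (by linarith)
  have hσ1 : σ = 1 := by
    rcases hσ with rfl | rfl
    · rfl
    · have : 0 < i * (q : ℤ) ^ l := by positivity
      linarith
  subst hσ1
  have hl0 : l = 0 := by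
    by_contra hne
    apply hqj
    have h1 : j = i * (q : ℤ) ^ l := by linarith
    rw [h1]
    exact (dvd_pow_self _ hne).mul_left _
  subst hl0
  exact ⟨rfl, by linarith, rfl⟩

theorem cases_of_dvd {i j : ℤ} (hi : 0 < i) (hj : 0 < j)
    (hi' : i ≤ 2 * (q : ℤ) ^ t - 2 * d - 2) (hj' : j ≤ 2 * (q : ℤ) ^ t - 2 * d - 2)
    (hqi : ¬ (q : ℤ) ∣ i) (hqj : ¬ (q : ℤ) ∣ j) {l : ℕ} (hl : l < 2 * (2 * t + 1))
    (hdvd : (n : ℤ) ∣ i * (q : ℤ) ^ l - j) :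
    (l = 0 ∧ i = j) ∨ ExceptionalPair q t d s i j ∨ ExceptionalPair q t d s j i := by
  have hneg : (n : ℤ) ∣ (q : ℤ) ^ (2 * t + 1) + 1 :=
    ⟨q + 1, by have := h.length; zify at this; exact this.symm⟩
  have h2t := h.two_le
  -- As `q ^ (2 * t + 1) ≡ -1`, the exponent folds to some `r ≤ t`, at the cost of a sign or of
  -- exchanging `i` and `j`.
  rcases (by omega : l ≤ t ∨ (t < l ∧ l ≤ 2 * t + 1) ∨ (2 * t + 1 < l ∧ l ≤ 2 * t + 1 + t) ∨
    2 * t + 1 + t < l) with hl | ⟨h1, h2⟩ | ⟨h1, h2⟩ | h1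
  · rcases hl.lt_or_eq with hlt | rfl
    · obtain ⟨h1, h2, _⟩ := h.eq_of_dvd_of_lt (Or.inl rfl) hi hj hi' hj' hqj hlt
        (σ := 1) (by rwa [one_mul])
      exact Or.inl ⟨h1, h2⟩
    · exact Or.inr (Or.inl (h.exceptionalPair_of_dvd (σ := 1) (Or.inl rfl) hi hj hi' hj' hqi hqj
        (by rwa [one_mul])))
  · obtain ⟨r, hr⟩ := Nat.exists_eq_add_of_le h2
    have hd' : (n : ℤ) ∣ j * (q : ℤ) ^ r - (-1) * i := by
      have e1 := (hneg.mul_left i).sub (hdvd.mul_left ((q : ℤ) ^ r))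
      rw [hr, pow_add] at e1
      convert! e1 using 1
      ring
    rcases (by omega : r ≤ t).lt_or_eq with hlt | rfl
    · have := (h.eq_of_dvd_of_lt (Or.inr rfl) hj hi hj' hi' hqi hlt hd').2.2
      norm_num at this
    · exact Or.inr (Or.inr (h.exceptionalPair_of_dvd (Or.inr rfl) hj hi hj' hi' hqj hqi hd'))
  · obtain ⟨r, hr⟩ := Nat.exists_eq_add_of_le h1.le
    have hd' : (n : ℤ) ∣ i * (q : ℤ) ^ r - (-1) * j := by
      have e1 := (hneg.mul_left (i * (q : ℤ) ^ r)).sub hdvd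
      rw [hr, pow_add] at e1
      convert! e1 using 1
      ring
    rcases (by omega : r ≤ t).lt_or_eq with hlt | rfl
    · have := (h.eq_of_dvd_of_lt (Or.inr rfl) hi hj hi' hj' hqj hlt hd').2.2
      norm_num at this
    · exact Or.inr (Or.inl (h.exceptionalPair_of_dvd (Or.inr rfl) hi hj hi' hj' hqi hqj hd'))
  · obtain ⟨r, hr⟩ := Nat.exists_eq_add_of_le hl.le
    have hd' : (n : ℤ) ∣ j * (q : ℤ) ^ r - 1 * i := by
      have e1 := (hneg.mul_left (i * ((q : ℤ) ^ (2 * t + 1) - 1))).sub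
        (hdvd.mul_left ((q : ℤ) ^ r))
      have e2 : (q : ℤ) ^ r * (q : ℤ) ^ l = (q : ℤ) ^ (2 * t + 1) * (q : ℤ) ^ (2 * t + 1) := by
        rw [← pow_add, ← pow_add]
        congr 1
        omega
      convert! e1 using 1
      linear_combination i * e2
    rcases (by omega : r ≤ t).lt_or_eq with hlt | rfl
    · have := (h.eq_of_dvd_of_lt (Or.inl rfl) hj hi hj' hi' hqi hlt hd').1
      omega
    · exact Or.inr (Or.inr (h.exceptionalPair_of_dvd (Or.inl rfl) hj hi hj' hi' hqj hqi hd'))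

/-- With `i = j` in `cases_of_dvd`, this leaves only `l = 0`: the coset has full size. -/
theorem not_exceptionalPair_self (i : ℤ) : ¬ ExceptionalPair q t d s i i := by
  have h1 := h.quot_pos
  have h2 := h.quot
  have h3 := h.five_le_int
  rintro (⟨h4, h5⟩ | ⟨h4, h5⟩)
  · rcases h.sign with h6 | h6 <;> nlinarith
  · rcases h.sign with h6 | h6 <;> omega

end CosetData

end CyclotomicCosets

/-! ### Arithmetic of the coset representatives. -/

section Representatives

namespace CosetData

variable {q t n : ℕ} {d s : ℤ} (h : CosetData q t n d s)
include h

theorem length_dvd : n ∣ q ^ (2 * t + 1) + 1 := ⟨_, h.length.symm⟩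

theorem length_pos : 0 < n := by
  rcases Nat.eq_zero_or_pos n with rfl | h0
  · have := h.length
    simp at this
  · exact h0

theorem pow_pow_eq_self {K : Type*} [Field K] {β : K} (hβ : IsPrimitiveRoot β n) (i : ℕ) :
    (β ^ i) ^ q ^ (2 * (2 * t + 1)) = β ^ i := by
  rw [← pow_mul, (hβ.isOfFinOrder h.length_pos.ne').pow_eq_pow_iff_modEq, ← hβ.eq_orderOf]
  refine (Nat.modEq_iff_dvd.2 ?_).symm
  have := (Int.natCast_dvd_natCast.2 h.length_dvd).mul_left
    ((i : ℤ) * ((q : ℤ) ^ (2 * t + 1) - 1))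
  convert! this using 1
  push_cast
  ring

theorem not_dvd_quot : ¬ (q : ℤ) ∣ d := by
  intro hd
  have h1 : (q : ℤ) ∣ s := by
    have := h.dvd_pow.sub (hd.mul_left ((q : ℤ) + 1))
    rwa [h.quot, sub_sub_cancel] at this
  have h2 := h.five_le_int
  have h3 := Int.le_of_dvd (by norm_num)
    (h1.trans (by rcases h.sign with rfl | rfl <;> norm_num : s ∣ 1))
  linarith

/-- Modulo `q` one has `d ≡ -s`, so the number is `2s`, nonzero because `q ≥ 5`. -/
theorem not_dvd_pow_sub_add : ¬ (q : ℤ) ∣ (q : ℤ) ^ t - d + s := by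
  intro hd
  have h1 : (q : ℤ) ∣ 2 * s := by
    have := (hd.mul_left ((q : ℤ) + 1)).sub (dvd_mul_right (q : ℤ) ((q : ℤ) ^ t + s))
    convert! this using 1
    linear_combination h.quot
  have h2 := h.five_le_int
  have h3 := Int.le_of_dvd (by norm_num)
    (h1.trans (by rcases h.sign with rfl | rfl <;> norm_num : 2 * s ∣ 2))
  linarith

/-- Shows that the first coincidence does occur: `(Q - d) Q ≡ s d` modulo `n`. -/
theorem length_eq : (n : ℤ) = ((q : ℤ) ^ t - d) * (q : ℤ) ^ t - s * d := by
  have hq1 : ((q : ℤ) + 1) ≠ 0 := by positivity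
  have hs2 : s * s = 1 := by rcases h.sign with rfl | rfl <;> norm_num
  refine mul_left_cancel₀ hq1 ?_
  linear_combination h.length_int + ((q : ℤ) ^ t + s) * h.quot - hs2

theorem length_eq' : (n : ℤ) = ((q : ℤ) ^ t - d + s) * (q : ℤ) ^ t - s * ((q : ℤ) ^ t + d) := by
  rw [h.length_eq]
  ring

theorem four_mul_quot_le : 4 * d ≤ (q : ℤ) ^ t := by
  have h1 := h.five_le_int
  have h2 := h.quot
  have h4 : -1 ≤ s := by rcases h.sign with h | h <;> omega
  have := h.quot_pos
  nlinarith

theorem lt_pow : 8 * t + 3 < q ^ t := by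
  refine lt_of_lt_of_le ?_ (Nat.pow_le_pow_left h.five_le t)
  obtain ⟨r, hr⟩ := Nat.exists_eq_add_of_le h.two_le
  rw [hr]
  clear hr
  induction r with
  | zero => norm_num
  | succ r ih =>
    rw [← add_assoc, pow_succ]
    omega

/-- Keeps the degree of either generator below `n`, so that both codes are nonzero. -/
theorem mul_lt_length {M : ℕ} (hM : (M : ℤ) ≤ 2 * (q : ℤ) ^ t - 2 * d - 2) :
    2 * (2 * t + 1) * M + 1 < n := by
  have hb := h.bound hM
  have hn := h.length_int
  have hlt : 8 * (t : ℤ) + 3 < (q : ℤ) ^ t := by exact_mod_cast h.lt_pow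
  have hq := h.five_le_int
  zify
  have hq1 : (0 : ℤ) < q + 1 := by positivity
  refine lt_of_mul_lt_mul_right ?_ hq1.le
  rw [hn]
  have h1 : 2 * (2 * (t : ℤ) + 1) * ((q + 1) * M) ≤
      2 * (2 * (t : ℤ) + 1) * (2 * q * (q : ℤ) ^ t - 2 * q) := by gcongr
  have h2 : (8 * (t : ℤ) + 4) * ((q : ℤ) ^ t - 1) < ((q : ℤ) ^ t + 1) * ((q : ℤ) ^ t - 1) := by
    apply mul_lt_mul_of_pos_right <;> linarith [Int.natCast_nonneg t]
  have h3 := mul_le_mul_of_nonneg_left (Int.add_one_le_of_lt h2) (by linarith : (0 : ℤ) ≤ q)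
  linarith

end CosetData

/-- The integers in `[1, M]` not divisible by `q` other than `e` and `a`. -/
def cosetReps (q M e a : ℕ) : Finset ℕ :=
  (({i ∈ Finset.Icc 1 M | ¬ q ∣ i}).erase e).erase a

theorem mem_cosetReps {q M e a i : ℕ} :
    i ∈ cosetReps q M e a ↔ i ≠ a ∧ i ≠ e ∧ (1 ≤ i ∧ i ≤ M) ∧ ¬ q ∣ i := by
  simp [cosetReps]

theorem card_filter_not_dvd (q M : ℕ) :
    ({i ∈ Finset.Icc 1 M | ¬ q ∣ i}).card + M / q = M := by
  have h1 := Finset.card_filter_add_card_filter_not (s := Finset.Icc 1 M) (fun i => q ∣ i)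
  have h2 : ({i ∈ Finset.Icc 1 M | q ∣ i}).card = M / q := Nat.Ioc_filter_dvd_card_eq_div M q
  rw [Nat.card_Icc] at h1
  omega

/-- Identifies `ε`, for `M = δ - 1`, with the number of integers in `[1, M]` not divisible by `q`.
-/
theorem ceil_mul_one_sub_inv (q M : ℕ) :
    ⌈(M : ℚ) * (1 - (q : ℚ)⁻¹)⌉ = (M : ℤ) - (M / q : ℕ) := by
  have : (M : ℚ) * (1 - (q : ℚ)⁻¹) = (M : ℤ) + -((M : ℚ) / q) := by
    push_cast
    ring
  rw [this, Int.ceil_intCast_add, Int.ceil_neg, ← sub_eq_add_neg]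
  congr 1
  rw [← Int.cast_natCast (R := ℚ) M, Rat.floor_intCast_div_natCast]
  rfl

end Representatives

/-! ### Degrees of the two generators. -/

section Dimension

variable {F K : Type*} [Field F] [Fintype F] [Field K] [Algebra F K] {t n : ℕ} {d s : ℤ}

theorem natCast_dvd_of_pow_eq {β : K} (hβ : IsPrimitiveRoot β n) (hn : 0 < n) {i j q l : ℕ}
    (h : β ^ j = (β ^ i) ^ q ^ l) : (n : ℤ) ∣ i * (q : ℤ) ^ l - j := by
  rw [← pow_mul, (hβ.isOfFinOrder hn.ne').pow_eq_pow_iff_modEq, ← hβ.eq_orderOf] at h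
  simpa using h.dvd

theorem pow_pow_mod {M : Type*} [Monoid M] {x : M} {q r : ℕ} (h : x ^ q ^ r = x) (l : ℕ) :
    x ^ q ^ l = x ^ q ^ (l % r) := by
  have h1 : ∀ k : ℕ, x ^ (q ^ r) ^ k = x := fun k => by
    induction k with
    | zero => simp
    | succ k ih => rw [pow_succ, pow_mul, ih, h]
  conv_lhs => rw [← Nat.div_add_mod l r, pow_add, pow_mul, pow_mul, h1]

theorem minpoly_eq_of_dvd {β : K} (hβ : IsPrimitiveRoot β n) (hn : 0 < n) (hint : IsIntegral F β)
    {m : ℕ} (hm : n ∣ Fintype.card F ^ m + 1) {i j l : ℕ} {σ : ℤ} (hσ : σ = 1 ∨ σ = -1)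
    (h : (n : ℤ) ∣ i * (Fintype.card F : ℤ) ^ l - σ * j) :
    minpoly F (β ^ i) = minpoly F (β ^ j) := by
  rw [← minpoly_pow_card_pow (hint.pow i) l]
  rcases hσ with rfl | rfl
  · congr 1
    rw [← pow_mul, (hβ.isOfFinOrder hn.ne').pow_eq_pow_iff_modEq, ← hβ.eq_orderOf]
    refine (Nat.modEq_iff_dvd.2 ?_).symm
    simpa using h
  · rw [← minpoly_pow_card_pow (hint.pow j) m]
    congr 1
    rw [← pow_mul, ← pow_mul, (hβ.isOfFinOrder hn.ne').pow_eq_pow_iff_modEq, ← hβ.eq_orderOf]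
    refine (Nat.modEq_iff_dvd.2 ?_).symm
    have h2 := h.sub ((Int.natCast_dvd_natCast.2 hm).mul_left (j : ℤ))
    convert! h2 using 1
    push_cast
    ring

namespace CosetData

variable (h : CosetData (Fintype.card F) t n d s)
include h

variable {β : K} (hβ : IsPrimitiveRoot β n) {M e a : ℕ}
  (hM : (M : ℤ) ≤ 2 * (Fintype.card F : ℤ) ^ t - 2 * d - 2)
  (he : (e : ℤ) = (Fintype.card F : ℤ) ^ t - d) (ha : (a : ℤ) = (Fintype.card F : ℤ) ^ t + d)
include hβ hM

theorem natDegree_minpoly (hint : IsIntegral F β) {i : ℕ}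
    (hi : i ∈ cosetReps (Fintype.card F) M e a) :
    (minpoly F (β ^ i)).natDegree = 2 * (2 * t + 1) := by
  obtain ⟨-, -, ⟨h1, h2⟩, hq⟩ := mem_cosetReps.1 hi
  refine natDegree_minpoly_eq_of_pow_card_pow (hint.pow i) (by omega)
    (h.pow_pow_eq_self hβ i) fun l hl hl' heq => ?_
  have hiM : (i : ℤ) ≤ 2 * (Fintype.card F : ℤ) ^ t - 2 * d - 2 := by omega
  have hqi : ¬ (Fintype.card F : ℤ) ∣ i := by exact_mod_cast hq
  rcases h.cases_of_dvd (by omega) (by omega) hiM hiM hqi hqi hl'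
    (natCast_dvd_of_pow_eq hβ h.length_pos heq.symm) with h3 | h3 | h3
  · omega
  · exact h.not_exceptionalPair_self _ h3
  · exact h.not_exceptionalPair_self _ h3

include he ha

/-- Every exceptional pair contains `e = Q - d` or `a = Q + d`, and both have been removed. -/
theorem eq_of_minpoly_eq [Finite K] {i j : ℕ} (hi : i ∈ cosetReps (Fintype.card F) M e a)
    (hj : j ∈ cosetReps (Fintype.card F) M e a) (hij : minpoly F (β ^ i) = minpoly F (β ^ j)) :
    i = j := by
  obtain ⟨hia, hie, ⟨h1, h2⟩, hqi⟩ := mem_cosetReps.1 hi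
  obtain ⟨hja, hje, ⟨h3, h4⟩, hqj⟩ := mem_cosetReps.1 hj
  obtain ⟨l, hl⟩ := exists_eq_pow_card_pow_of_minpoly_eq hij
  rw [pow_pow_mod (h.pow_pow_eq_self hβ i)] at hl
  rcases h.cases_of_dvd (i := i) (j := j) (by omega) (by omega) (by omega) (by omega)
    (by exact_mod_cast hqi) (by exact_mod_cast hqj) (Nat.mod_lt _ (by omega))
    (natCast_dvd_of_pow_eq hβ h.length_pos hl) with h5 | h5 | h5
  · exact_mod_cast h5.2
  · unfold ExceptionalPair at h5
    omega
  · unfold ExceptionalPair at h5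
    omega

theorem exists_minpoly_eq (hM' : (Fintype.card F : ℤ) ^ t + 1 ≤ M) (hint : IsIntegral F β) {i : ℕ}
    (hi : i ∈ Finset.Icc 1 M) :
    ∃ j ∈ cosetReps (Fintype.card F) M e a, minpoly F (β ^ i) = minpoly F (β ^ j) := by
  rw [Finset.mem_Icc] at hi
  have h5 := h.five_le
  have hd := h.quot_pos
  have hd' := h.four_mul_quot_le
  obtain ⟨v, r, hr, hir⟩ := Nat.exists_eq_pow_mul_and_not_dvd (n := i) (by omega)
    (Fintype.card F) (by omega)
  have hmin : minpoly F (β ^ i) = minpoly F (β ^ r) := by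
    rw [← minpoly_pow_card_pow (hint.pow r) v, hir, ← pow_mul, mul_comm]
  have hr1 : 1 ≤ r := Nat.one_le_iff_ne_zero.2 (by rintro rfl; simp at hr)
  have hrM : r ≤ M := by
    have : r ≤ i := hir ▸ Nat.le_mul_of_pos_left r (Nat.pow_pos (by omega))
    omega
  rw [hmin]
  by_cases hre : r = e
  · lift d to ℕ using (by omega) with d'
    refine ⟨d', mem_cosetReps.2 ⟨by omega, by omega, by omega, ?_⟩, ?_⟩
    · exact_mod_cast h.not_dvd_quot
    · refine minpoly_eq_of_dvd hβ h.length_pos hint h.length_dvd (l := t) h.sign ?_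
      rw [hre, he, ← h.length_eq]
  by_cases hra : r = a
  · have hs := h.sign
    obtain ⟨j, hj⟩ := Int.eq_ofNat_of_zero_le
      (by omega : 0 ≤ (Fintype.card F : ℤ) ^ t - d + s)
    refine ⟨j, mem_cosetReps.2 ⟨by omega, by omega, by omega, ?_⟩, ?_⟩
    · have := h.not_dvd_pow_sub_add
      rw [hj] at this
      exact_mod_cast this
    · refine (minpoly_eq_of_dvd hβ h.length_pos hint h.length_dvd (l := t) h.sign ?_).symm
      rw [hra, ha, ← hj, ← h.length_eq']
  · exact ⟨r, mem_cosetReps.2 ⟨hra, hre, ⟨hr1, hrM⟩, hr⟩, rfl⟩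

theorem natDegree_bchGenerator_one [Finite K] (hM' : (Fintype.card F : ℤ) ^ t + 1 ≤ M) :
    (bchGenerator F β (M + 1) 1).natDegree =
      2 * (2 * t + 1) * (cosetReps (Fintype.card F) M e a).card := by
  have hint : IsIntegral F β := Algebra.IsIntegral.isIntegral β
  have hM1 : 1 + (M + 1) - 2 = M := by omega
  rw [natDegree_bchGenerator hint (M + 1) 1 (cosetReps (Fintype.card F) M e a)]
  · rw [Finset.sum_congr rfl fun i hi => h.natDegree_minpoly hβ hM hint hi, Finset.sum_const,
      smul_eq_mul, mul_comm]
  · intro i hi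
    rw [hM1, Finset.mem_Icc]
    exact (mem_cosetReps.1 hi).2.2.1
  · exact fun i hi j hj => h.eq_of_minpoly_eq hβ hM he ha hi hj
  · rw [hM1]
    exact fun i hi => h.exists_minpoly_eq hβ hM he ha hM' hint hi

theorem natDegree_bchGenerator_zero [Finite K] (hM' : (Fintype.card F : ℤ) ^ t + 1 ≤ M) :
    (bchGenerator F β (M + 2) 0).natDegree =
      2 * (2 * t + 1) * (cosetReps (Fintype.card F) M e a).card + 1 := by
  have hint : IsIntegral F β := Algebra.IsIntegral.isIntegral β
  have hM1 : 0 + (M + 2) - 2 = M := by omega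
  have h0 : (minpoly F (β ^ 0)).natDegree = 1 := by rw [pow_zero, minpoly.one, ← C_1, natDegree_X_sub_C]
  have h0R : 0 ∉ cosetReps (Fintype.card F) M e a := by simp [mem_cosetReps]
  -- The exponent `0` adds the factor `X - 1`, told apart from the others by its degree.
  have hne : ∀ i ∈ cosetReps (Fintype.card F) M e a, minpoly F (β ^ 0) ≠ minpoly F (β ^ i) := by
    intro i hi heq
    have := h.natDegree_minpoly hβ hM hint hi
    rw [← heq, h0] at this
    omega
  rw [natDegree_bchGenerator hint (M + 2) 0 (insert 0 (cosetReps (Fintype.card F) M e a))]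
  · rw [Finset.sum_insert h0R, h0,
      Finset.sum_congr rfl fun i hi => h.natDegree_minpoly hβ hM hint hi, Finset.sum_const,
      smul_eq_mul, mul_comm, add_comm]
  · intro i hi
    rw [hM1, Finset.mem_Icc]
    rcases Finset.mem_insert.1 hi with rfl | hi
    · omega
    · exact ⟨by omega, (mem_cosetReps.1 hi).2.2.1.2⟩
  · intro i hi j hj hij
    rcases Finset.mem_insert.1 hi with rfl | hi <;> rcases Finset.mem_insert.1 hj with rfl | hj
    · rfl
    · exact absurd hij (hne j hj)
    · exact absurd hij.symm (hne i hi)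
    · exact h.eq_of_minpoly_eq hβ hM he ha hi hj hij
  · rw [hM1]
    intro i hi
    rcases Nat.eq_zero_or_pos i with rfl | hpos
    · exact ⟨0, Finset.mem_insert_self _ _, rfl⟩
    · obtain ⟨j, hj, hij⟩ := h.exists_minpoly_eq hβ hM he ha hM' hint
        (Finset.mem_Icc.2 ⟨hpos, (Finset.mem_Icc.1 hi).2⟩)
      exact ⟨j, Finset.mem_insert_of_mem hj, hij⟩

end CosetData

end Dimension

/-! ### Counting the representatives and the final assembly. -/

theorem CosetData.not_dvd_pow_sub {q t n : ℕ} {d s : ℤ} (h : CosetData q t n d s) :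
    ¬ (q : ℤ) ∣ (q : ℤ) ^ t - d := fun hd => h.not_dvd_quot ((dvd_sub_right h.dvd_pow).1 hd)

theorem CosetData.not_dvd_pow_add {q t n : ℕ} {d s : ℤ} (h : CosetData q t n d s) :
    ¬ (q : ℤ) ∣ (q : ℤ) ^ t + d := fun hd => h.not_dvd_quot ((dvd_add_right h.dvd_pow).1 hd)

/-- The removed `e` always lies in the range, while `a` does so only when `a ≤ M`; hence the two
cases for the dimension. -/
theorem card_cosetReps {q M e a : ℕ} (he0 : 1 ≤ e) (heM : e ≤ M) (hea : e < a) (he : ¬ q ∣ e)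
    (ha : ¬ q ∣ a) : (cosetReps q M e a).card + (if M < a then 1 else 2) =
      ({i ∈ Finset.Icc 1 M | ¬ q ∣ i}).card := by
  have heN : e ∈ ({i ∈ Finset.Icc 1 M | ¬ q ∣ i} : Finset ℕ) := by simp [he, he0, heM]
  have h1 := Finset.card_erase_add_one heN
  unfold cosetReps
  split_ifs with hMa
  · rw [Finset.erase_eq_of_notMem (a := a), h1]
    simp [hMa]
  · have h2 := Finset.card_erase_add_one
      (s := ({i ∈ Finset.Icc 1 M | ¬ q ∣ i} : Finset ℕ).erase e) (a := a)
      (by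
        simp only [Finset.mem_erase, Finset.mem_filter, Finset.mem_Icc]
        exact ⟨by omega, by omega, ha⟩)
    omega

theorem theorem8 {F K : Type*} [Field F] [Fintype F] [DecidableEq F] [Field K] [Algebra F K]
    (q m t n δ : ℕ) (hq : Fintype.card F = q) (hodd : Odd q) (hq5 : 5 ≤ q)
    (hm : m = 2 * t + 1) (hm5 : 5 ≤ m) (hn : n * (q + 1) = q ^ m + 1)
    (β : K) (hβ : IsPrimitiveRoot β n)
    (ε k : ℤ) (hε : ε = ⌈((δ : ℚ) - 1) * (1 - (q : ℚ)⁻¹)⌉)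
    (A B : ℚ)
    (hA : A = if Odd t then ((q : ℚ) ^ (t + 1) + 2 * (q : ℚ) ^ t + 1) / ((q : ℚ) + 1)
      else ((q : ℚ) ^ (t + 1) + 2 * (q : ℚ) ^ t - 1) / ((q : ℚ) + 1))
    (hB : B = if Odd t then 2 * (((q : ℚ) ^ (t + 1) - 1) / ((q : ℚ) + 1)) - 1
      else 2 * (((q : ℚ) ^ (t + 1) + 1) / ((q : ℚ) + 1)) - 1)
    (hk : ((q : ℚ) ^ t + 2 ≤ (δ : ℚ) ∧ (δ : ℚ) ≤ A ∧
            k = (n : ℤ) - 2 * (m : ℤ) * (ε - 1)) ∨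
          (A + 1 ≤ (δ : ℚ) ∧ (δ : ℚ) ≤ B ∧
            k = (n : ℤ) - 2 * (m : ℤ) * (ε - 2))) :
    (IsLCD (bchCode F β n δ 1) ∧
      (Module.finrank F (bchCode F β n δ 1) : ℤ) = k ∧
      δ ≤ minDistance (bchCode F β n δ 1 : Set (Fin n → F))) ∧
    (IsLCD (bchCode F β n (δ + 1) 0) ∧
      (Module.finrank F (bchCode F β n (δ + 1) 0) : ℤ) = k - 1 ∧
      2 * δ ≤ minDistance (bchCode F β n (δ + 1) 0 : Set (Fin n → F))) := by
  subst hq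
  have ht : 2 ≤ t := by omega
  obtain ⟨d, hd⟩ : ((Fintype.card F : ℤ) + 1) ∣ (Fintype.card F : ℤ) ^ t - (-1) ^ t := by
    have := sub_dvd_pow_sub_pow (Fintype.card F : ℤ) (-1) t
    rwa [sub_neg_eq_add] at this
  have h : CosetData (Fintype.card F) t n d ((-1) ^ t) :=
    ⟨hq5, hodd, ht, hm ▸ hn, neg_one_pow_eq_or ℤ t, hd.symm⟩
  have hdQ : ((Fintype.card F : ℚ) + 1) * d = (Fintype.card F : ℚ) ^ t - (-1) ^ t := by
    exact_mod_cast hd.symm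
  have hqQ : (Fintype.card F : ℚ) + 1 ≠ 0 := by positivity
  have hA' : A = (Fintype.card F : ℚ) ^ t + d := by
    rw [hA]
    split_ifs with hodd_t
    · rw [hodd_t.neg_one_pow] at hdQ
      field_simp
      linear_combination -hdQ
    · rw [(Nat.not_odd_iff_even.1 hodd_t).neg_one_pow] at hdQ
      field_simp
      linear_combination -hdQ
  have hB' : B = 2 * (Fintype.card F : ℚ) ^ t - 2 * d - 1 := by
    rw [hB]
    split_ifs with hodd_t
    · rw [hodd_t.neg_one_pow] at hdQ
      field_simp
      linear_combination 2 * hdQ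
    · rw [(Nat.not_odd_iff_even.1 hodd_t).neg_one_pow] at hdQ
      field_simp
      linear_combination 2 * hdQ
  have hd4 := h.quot_pos
  have hdq := h.four_mul_quot_le
  rw [hA', hB'] at hk
  have hδ : (Fintype.card F : ℤ) ^ t + 2 ≤ δ ∧
      (δ : ℤ) ≤ 2 * (Fintype.card F : ℤ) ^ t - 2 * d - 1 ∧
      k = n - 2 * m * (ε - if (δ : ℤ) ≤ (Fintype.card F : ℤ) ^ t + d then 1 else 2) := by
    rcases hk with ⟨h1, h2, h3⟩ | ⟨h1, h2, h3⟩
    · have h1' : (Fintype.card F : ℤ) ^ t + 2 ≤ δ := by exact_mod_cast h1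
      have h2' : (δ : ℤ) ≤ (Fintype.card F : ℤ) ^ t + d := by exact_mod_cast h2
      rw [if_pos h2']
      exact ⟨h1', by omega, h3⟩
    · have h1' : (Fintype.card F : ℤ) ^ t + d + 1 ≤ δ := by exact_mod_cast h1
      have h2' : (δ : ℤ) ≤ 2 * (Fintype.card F : ℤ) ^ t - 2 * d - 1 := by exact_mod_cast h2
      rw [if_neg (by omega)]
      exact ⟨by omega, h2', h3⟩
  clear hk
  obtain ⟨hδ1, hδ2, hk⟩ := hδ
  obtain ⟨M, rfl⟩ : ∃ M, δ = M + 1 := ⟨δ - 1, by omega⟩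
  push_cast at hδ1 hδ2 hk
  obtain ⟨e, he⟩ := Int.eq_ofNat_of_zero_le (by omega : 0 ≤ (Fintype.card F : ℤ) ^ t - d)
  obtain ⟨a, ha⟩ := Int.eq_ofNat_of_zero_le (by omega : 0 ≤ (Fintype.card F : ℤ) ^ t + d)
  have hM : (M : ℤ) ≤ 2 * (Fintype.card F : ℤ) ^ t - 2 * d - 2 := by omega
  have hM' : (Fintype.card F : ℤ) ^ t + 1 ≤ M := by omega
  have hcard : ((cosetReps (Fintype.card F) M e a).card : ℤ) =
      ε - if (M : ℤ) + 1 ≤ (Fintype.card F : ℤ) ^ t + d then 1 else 2 := by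
    have hε' : ε = (M : ℤ) - (M / Fintype.card F : ℕ) := by
      rw [hε, ← ceil_mul_one_sub_inv]
      push_cast
      rw [add_sub_cancel_right]
    have := card_filter_not_dvd (Fintype.card F) M
    have he' := h.not_dvd_pow_sub
    have ha' := h.not_dvd_pow_add
    rw [he, Int.natCast_dvd_natCast] at he'
    rw [ha, Int.natCast_dvd_natCast] at ha'
    have hlt := card_cosetReps (q := Fintype.card F) (M := M) (e := e) (a := a)
      (by omega) (by omega) (by omega) he' ha'
    split_ifs at hlt ⊢ <;> omega
  have hcardM : (cosetReps (Fintype.card F) M e a).card ≤ M := by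
    refine (Finset.card_le_card (t := Finset.Icc 1 M) fun i hi => ?_).trans (by simp)
    exact Finset.mem_Icc.2 (mem_cosetReps.1 hi).2.2.1
  have hnlt := h.mul_lt_length hM
  have hnlt' : 2 * (2 * t + 1) * (cosetReps (Fintype.card F) M e a).card + 1 < n :=
    lt_of_le_of_lt (by gcongr) hnlt
  have hMn : M + 1 ≤ n := by
    have := Nat.le_mul_of_pos_left M (by omega : 0 < 2 * (2 * t + 1))
    omega
  have hn0 : 0 < n := by omega
  have : NeZero n := ⟨hn0.ne'⟩
  have hint : IsIntegral F β := IsIntegral.of_pow hn0 (by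
    rw [hβ.pow_eq_one]
    exact isIntegral_one)
  -- `K` may be infinite, whereas the conjugacy argument needs a finite field. The codes depend only
  -- on minimal polynomials, so `β` is replaced by its copy in `F(β)`.
  let L := IntermediateField.adjoin F {β}
  have : FiniteDimensional F L := IntermediateField.adjoin.finiteDimensional hint
  have : Finite L := Module.finite_of_finite F
  let γ : L := IntermediateField.AdjoinSimple.gen F β
  have hγβ : algebraMap L K γ = β := IntermediateField.AdjoinSimple.algebraMap_gen F β
  have hγ : IsPrimitiveRoot γ n :=
    IsPrimitiveRoot.of_map_of_injective (f := algebraMap L K) (by rwa [hγβ])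
      (algebraMap L K).injective
  have hcongr : ∀ i : ℕ, minpoly F (β ^ i) = minpoly F (γ ^ i) := fun i => by
    rw [← hγβ, ← map_pow, minpoly.algebraMap_eq (algebraMap L K).injective]
  rw [bchCode_congr hcongr n (M + 1) 1, bchCode_congr hcongr n (M + 1 + 1) 0]
  have hneg := h.length_dvd
  have hr1 : (Module.finrank F (bchCode F γ n (M + 1) 1) : ℤ) = k ∧
      0 < Module.finrank F (bchCode F γ n (M + 1) 1) := by
    have := finrank_cyclicCode hn0 (bchGenerator_dvd_X_pow_sub_one (F := F) hγ.pow_eq_one (M + 1) 1)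
    rw [h.natDegree_bchGenerator_one hγ hM he.symm ha.symm hM'] at this
    unfold bchCode
    refine ⟨?_, by omega⟩
    rw [hk, ← hcard, hm]
    zify at this
    push_cast
    linarith
  have hr0 : (Module.finrank F (bchCode F γ n (M + 2) 0) : ℤ) = k - 1 ∧
      0 < Module.finrank F (bchCode F γ n (M + 2) 0) := by
    have := finrank_cyclicCode hn0 (bchGenerator_dvd_X_pow_sub_one (F := F) hγ.pow_eq_one (M + 2) 0)
    rw [h.natDegree_bchGenerator_zero hγ hM he.symm ha.symm hM'] at this
    unfold bchCode
    refine ⟨?_, by omega⟩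
    rw [hk, ← hcard, hm]
    zify at this
    push_cast
    linarith
  have hne : ∀ C : Submodule F (Fin n → F), 0 < Module.finrank F C → C ≠ ⊥ := by
    rintro C hC rfl
    simp at hC
  exact ⟨⟨isLCD_bchCode hγ hneg _ _, hr1.1,
      le_minDistance_bchCode_one hγ (by omega) (hne _ hr1.2)⟩,
    isLCD_bchCode hγ hneg _ _, hr0.1,
      two_mul_le_minDistance_bchCode_zero hγ hneg (by omega) hMn (hne _ hr0.2)⟩
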